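/- **Theorem A.** Let $K$ be an infinite field, $N\ge 3$, $R=K[x_0,\dots,x_N]$ the homogeneous coordinate ring of $\mathbb P^N$. For an ideal $I\subset R$ put $I^{(k)}=\bigcap_{P\in \mathrm{Ass}(R/I)}\left(R\cap I^kR_P\right)$, let $\alpha(I)$ be the least degree of a nonzero homogeneous element of $I$, and let $\widehat\alpha(I)=\lim_{k\to\infty}\alpha(I^{(k)})/k=\inf_{k\ge1}\alpha(I^{(k)})/k$ be its Waldschmidt constant. A *fat flat subscheme* of $\mathbb P^N$ is one defined by an ideal $I(W)=\bigcap_i I(L_i)^{m_i}$, where the $L_i$ are finitely many (at least one) nonempty proper linear subspaces, none of which contains another, and $m_i\ge 1$. For every positive integer $d$ there is a fat flat subscheme $W$ of $\mathbb P^N$ with $\alpha(I(W)^{(k)})=dk$ for all $k\ge1$; in particular $\widehat\alpha(I(W))=d$. More precisely, let $d=st$ with $s,t\ge1$, let $1\le e\le N$ with $e\le s$, and put $m=et$. There exist hyperplanes $H_1,\dots,H_s$ in $\mathbb P^N$ in general position (any at most $N+1$ of them have linearly independent equations). For any such hyperplanes, let $S_N(e,s)$ be the star configuration consisting of the $\binom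 se$ intersections $L$ of $e$ of the $H_j$, with ideal $I(S_N(e,s))=\bigcap_L I(L)$. Let $M_1,\dots,M_n$ ($n\ge 0$) be distinct linear subspaces of codimensions between $2$ and $N$, each contained in $\bigcup_j H_j$, with multiplicities $0\le m_i\le t$, such that no $M_i$ with $m_i\geq 1$ contains one of the subspaces $L$ of $S_N(e,s)$. Let $W=\sum_i m_iM_i+m\,S_N(e,s)$ be defined by $I(W)=\bigcap_i I(M_i)^{(m_i)}\cap I(S_N(e,s))^{(m)}$. Then $\alpha(I(W)^{(k)})=dk$ for every $k\ge1$, and $\widehat\alpha(I(W))=d$. If moreover none of the subspaces among the $L$'s and the $M_i$ with $m_i\ge1$ contains another, then $W$ is a fat flat subscheme. -/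

import Mathlib

open MvPolynomial Filter Topology

namespace FatFlat

noncomputable section

/-- The homogeneous coordinate ring `K[x₀, …, x_N]` of `ℙ^N` over `K`. -/
abbrev CoordRing (K : Type*) [Field K] (N : ℕ) : Type _ := MvPolynomial (Fin (N + 1)) K

/-- A linear subspace of `ℙ^N` is given by the corresponding vector subspace of `K^(N+1)`. -/
abbrev LinSub (K : Type*) [Field K] (N : ℕ) : Type _ := Submodule K (Fin (N + 1) → K)

variable {K : Type*} [Field K] {N : ℕ}

/-- The codimension in `ℙ^N` of a linear subspace (equal to that of its cone in `K^(N+1)`). -/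
def codim (L : LinSub K N) : ℕ := Module.finrank K ((Fin (N + 1) → K) ⧸ L)

/-- The linear form `∑ φ(eᵢ) xᵢ` attached to a linear functional `φ` on `K^(N+1)`. -/
def linForm (φ : Module.Dual K (Fin (N + 1) → K)) : CoordRing K N :=
  ∑ i, C (φ (Pi.single i 1)) * X i

/-- The ideal `I(L)` of a linear subspace `L`, generated by the linear forms vanishing on `L`. -/
def linIdeal (L : LinSub K N) : Ideal (CoordRing K N) :=
  Ideal.span (linForm '' (L.dualAnnihilator : Set (Module.Dual K (Fin (N + 1) → K))))

/-- The symbolic power `I^(m)`: the intersection, over the associated primes `P` of `I`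
(that is, of `R ⧸ I`), of the contractions to `R` of `I^m R_P`. -/
def symbolicPower {R : Type*} [CommRing R] (I : Ideal R) (m : ℕ) : Ideal R :=
  ⨅ (P : Ideal R) (hP : P ∈ associatedPrimes R (R ⧸ I)),
    haveI : P.IsPrime := hP.isPrime
    ((I ^ m).map (algebraMap R (Localization.AtPrime P))).comap
      (algebraMap R (Localization.AtPrime P))

/-- `α(I)`: the least degree of a nonzero homogeneous element of `I`. -/
def alpha (I : Ideal (CoordRing K N)) : ℕ :=
  sInf {t : ℕ | ∃ F ∈ I, F ≠ 0 ∧ F.IsHomogeneous t}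

/-- `c` is the Waldschmidt constant of `I`: the limit, as well as the infimum over `k ≥ 1`,
of `α(I^(k)) / k`. -/
def IsWaldschmidtConstant (I : Ideal (CoordRing K N)) (c : ℝ) : Prop :=
  Tendsto (fun k : ℕ => (alpha (symbolicPower I k) : ℝ) / k) atTop (𝓝 c) ∧
    IsGLB {x : ℝ | ∃ k : ℕ, 1 ≤ k ∧ x = (alpha (symbolicPower I k) : ℝ) / k} c

/-- `I` is the ideal of a fat flat subscheme of `ℙ^N`: `I = ⋂ I(L)^(m L)`, where `L` runs over a
finite nonempty set of nonempty proper linear subspaces of `ℙ^N`, none of which contains another,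
and the multiplicities `m L` are positive. -/
def IsFatFlatIdeal (I : Ideal (CoordRing K N)) : Prop :=
  ∃ (S : Finset (LinSub K N)) (m : LinSub K N → ℕ),
    S.Nonempty ∧ (∀ L ∈ S, L ≠ ⊥ ∧ L ≠ ⊤ ∧ 1 ≤ m L) ∧
    IsAntichain (· ≤ ·) (S : Set (LinSub K N)) ∧
    I = ⨅ L ∈ S, linIdeal L ^ m L

/-- The hyperplanes `ker (H j)` of `ℙ^N` are in general position: at most `N + 1` of them always
have linearly independent equations. -/
def InGeneralPosition {s : ℕ} (H : Fin s → Module.Dual K (Fin (N + 1) → K)) : Prop :=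
  ∀ J : Finset (Fin s), J.card ≤ N + 1 → LinearIndependent K (fun j : J => H j)

/-- The linear subspaces of the star configuration `S_N(e, s)`: the intersections of `e` of the
`s` hyperplanes. -/
def starSubspaces {s : ℕ} (H : Fin s → Module.Dual K (Fin (N + 1) → K)) (e : ℕ) :
    Set (LinSub K N) :=
  {L | ∃ J : Finset (Fin s), J.card = e ∧ L = ⨅ j ∈ J, LinearMap.ker (H j)}

/-- The ideal `I(S_N(e, s))` of the star configuration. -/
def starIdeal {s : ℕ} (H : Fin s → Module.Dual K (Fin (N + 1) → K)) (e : ℕ) :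
    Ideal (CoordRing K N) :=
  ⨅ L ∈ starSubspaces H e, linIdeal L

/-- The data of `W'` (a finite set `T` of linear subspaces with multiplicities `μ`): the members
of `T` have codimension between `2` and `N`, lie in the union of the hyperplanes, have
multiplicity at most `t`, and those with positive multiplicity contain no subspace of the star
configuration. -/
structure IsAdmissible {s : ℕ} (H : Fin s → Module.Dual K (Fin (N + 1) → K)) (e t : ℕ)
    (T : Finset (LinSub K N)) (μ : LinSub K N → ℕ) : Prop where
  codim_mem : ∀ M ∈ T, 2 ≤ codim M ∧ codim M ≤ N
  subset_union : ∀ M ∈ T, (M : Set (Fin (N + 1) → K)) ⊆ ⋃ j, (LinearMap.ker (H j) : Set _)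
  mult_le : ∀ M ∈ T, μ M ≤ t
  not_star_le : ∀ M ∈ T, 0 < μ M → ∀ L ∈ starSubspaces H e, ¬ L ≤ M

/-- The ideal `I(W)` of `W = W' + m S_N(e, s)`, where `W' = ∑ μ(M) M` over `M ∈ T`. -/
def ideal {s : ℕ} (H : Fin s → Module.Dual K (Fin (N + 1) → K)) (e m : ℕ)
    (T : Finset (LinSub K N)) (μ : LinSub K N → ℕ) : Ideal (CoordRing K N) :=
  (⨅ M ∈ T, symbolicPower (linIdeal M) (μ M)) ⊓ symbolicPower (starIdeal H e) m

end

end FatFlat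

/-! The product of the `s` linear forms, raised to the power `t`, has degree `st` and lies in
`I(W)`: each `L` of the star lies on `e` of the hyperplanes, and each `M` lies on one of them
because `K` is infinite (`prod_linForm_pow_mem_ideal`). Its powers bound `α` from above.

For the lower bound, no `M` of positive multiplicity contains an `L`, so `I(L)` is a minimal prime
of `I(W)`. Since powers of `I(L)` are primary, `I(W)^(k)` lies in `I(L)^(mk)`
(`symbolicPower_ideal_le`). They are primary because the order of vanishing along `L` is the
`T`-order of `F (p v + T (v - p v))`, with `p` a projection onto `L`, and `T` is prime
(`mem_linIdeal_pow_iff`).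

It remains to bound below the degree of a form with prescribed orders along the `L`'s
(`sum_order_le_choose_mul_degree`), by induction on their codimension. Hyperplanes dividing the form
are divided out, each costing one degree. If none divides it, its restrictions to the hyperplanes
are nonzero, the codimension drops by one, and the resulting inequalities are summed. With all
orders equal to `mk = etk`, the identity `e * choose s e = s * choose (s-1) (e-1)` turns the bound
into `stk`. -/

namespace FatFlat
noncomputable section
variable {K : Type*} [Field K] {N : ℕ}

/-! ### Linear forms and linear substitutions -/

/-- `linForm` as a linear map. -/
def linFormHom : Module.Dual K (Fin (N + 1) → K) →ₗ[K] CoordRing K N where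
  toFun := linForm
  map_add' φ ψ := by simp [linForm, add_mul, Finset.sum_add_distrib]
  map_smul' c φ := by simp [linForm, Finset.mul_sum, mul_assoc, smul_eq_C_mul]

@[simp]
theorem linFormHom_apply (φ : Module.Dual K (Fin (N + 1) → K)) : linFormHom φ = linForm φ := rfl

@[simp]
theorem linForm_zero : linForm (0 : Module.Dual K (Fin (N + 1) → K)) = 0 :=
  map_zero linFormHom

theorem linForm_smul (c : K) (φ : Module.Dual K (Fin (N + 1) → K)) :
    linForm (c • φ) = c • linForm φ :=
  map_smul linFormHom c φ

theorem linForm_sub (φ ψ : Module.Dual K (Fin (N + 1) → K)) :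
    linForm (φ - ψ) = linForm φ - linForm ψ :=
  map_sub linFormHom φ ψ

theorem coeff_linForm (φ : Module.Dual K (Fin (N + 1) → K)) (i : Fin (N + 1)) :
    coeff (Finsupp.single i 1) (linForm φ) = φ (Pi.single i 1) := by
  simp [linForm, coeff_sum, coeff_C_mul, coeff_X, Finsupp.single_left_inj]

theorem linForm_injective :
    Function.Injective (linForm : Module.Dual K (Fin (N + 1) → K) → CoordRing K N) := by
  intro φ ψ h
  refine LinearMap.pi_ext' fun i => LinearMap.ext_ring ?_
  simpa [coeff_linForm] using congrArg (coeff (Finsupp.single i 1)) h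

theorem linForm_ne_zero {φ : Module.Dual K (Fin (N + 1) → K)} (h : φ ≠ 0) : linForm φ ≠ 0 :=
  fun h0 => h (linForm_injective (h0.trans linForm_zero.symm))

theorem isHomogeneous_linForm (φ : Module.Dual K (Fin (N + 1) → K)) :
    (linForm φ).IsHomogeneous 1 :=
  IsHomogeneous.sum _ _ _ fun i _ => isHomogeneous_C_mul_X _ i

theorem linForm_proj (i : Fin (N + 1)) :
    linForm (LinearMap.proj i : Module.Dual K (Fin (N + 1) → K)) = X i := by
  simp [linForm, Pi.single_apply]

/-- Both sides are linear in `φ`, so the coordinate functionals decide. This computes `pullback` and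
`deform` on linear forms. -/
theorem algHom_linForm {A : Type*} [CommRing A] [Algebra K A] (g : CoordRing K N →ₐ[K] A)
    (l : Module.Dual K (Fin (N + 1) → K) →ₗ[K] A)
    (h : ∀ i, g (X i) = l (LinearMap.proj i)) (φ : Module.Dual K (Fin (N + 1) → K)) :
    g (linForm φ) = l φ := by
  have hφ : φ = ∑ i, φ (Pi.single i 1) • (LinearMap.proj i : Module.Dual K (Fin (N + 1) → K)) := by
    refine LinearMap.pi_ext' fun i => LinearMap.ext_ring ?_
    simp [Pi.single_apply]
  conv_rhs => rw [hφ]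
  simp [linForm, ← smul_eq_C_mul, h]

/-- The substitution `F ↦ F ∘ f` on polynomials. -/
def pullback (f : (Fin (N + 1) → K) →ₗ[K] (Fin (N + 1) → K)) :
    CoordRing K N →ₐ[K] CoordRing K N :=
  aeval fun i => linForm (LinearMap.proj i ∘ₗ f)

theorem pullback_linForm (f : (Fin (N + 1) → K) →ₗ[K] (Fin (N + 1) → K))
    (φ : Module.Dual K (Fin (N + 1) → K)) : pullback f (linForm φ) = linForm (φ ∘ₗ f) :=
  algHom_linForm (pullback f)
    { toFun := fun φ => linForm (φ ∘ₗ f)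
      map_add' := fun φ ψ => by
        rw [LinearMap.add_comp]; exact map_add linFormHom _ _
      map_smul' := fun c φ => by
        rw [LinearMap.smul_comp]; exact map_smul linFormHom _ _ }
    (fun i => aeval_X _ i) φ

theorem isHomogeneous_pullback (f : (Fin (N + 1) → K) →ₗ[K] (Fin (N + 1) → K))
    {F : CoordRing K N} {n : ℕ} (hF : F.IsHomogeneous n) : (pullback f F).IsHomogeneous n := by
  have := hF.aeval (fun i => linForm (LinearMap.proj i ∘ₗ f)) fun i => isHomogeneous_linForm _
  rwa [one_mul] at this

theorem sub_pullback_mem (f : (Fin (N + 1) → K) →ₗ[K] (Fin (N + 1) → K))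
    (I : Ideal (CoordRing K N))
    (h : ∀ i, X i - linForm (LinearMap.proj i ∘ₗ f) ∈ I) (F : CoordRing K N) :
    F - pullback f F ∈ I := by
  have : (Ideal.Quotient.mkₐ K I) = (Ideal.Quotient.mkₐ K I).comp (pullback f) := by
    refine MvPolynomial.algHom_ext fun i => ?_
    rw [AlgHom.comp_apply, ← linForm_proj i, pullback_linForm, linForm_proj]
    exact Ideal.Quotient.eq.2 (h i)
  exact Ideal.Quotient.eq.1 (DFunLike.congr_fun this F)

/-! ### Order of vanishing along a linear subspace -/

/-- The one-parameter family `F ↦ F (p v + T (v - p v))`. -/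
def deform (p : (Fin (N + 1) → K) →ₗ[K] (Fin (N + 1) → K)) :
    CoordRing K N →ₐ[K] Polynomial (CoordRing K N) :=
  aeval fun i => Polynomial.C (linForm (LinearMap.proj i ∘ₗ p)) +
    Polynomial.X * Polynomial.C (linForm (LinearMap.proj i - LinearMap.proj i ∘ₗ p))

theorem deform_linForm (p : (Fin (N + 1) → K) →ₗ[K] (Fin (N + 1) → K))
    (φ : Module.Dual K (Fin (N + 1) → K)) :
    deform p (linForm φ) = Polynomial.C (linForm (φ ∘ₗ p)) +
      Polynomial.X * Polynomial.C (linForm (φ - φ ∘ₗ p)) :=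
  algHom_linForm (deform p)
    { toFun := fun φ => Polynomial.C (linForm (φ ∘ₗ p)) +
        Polynomial.X * Polynomial.C (linForm (φ - φ ∘ₗ p))
      map_add' := fun φ ψ => by
        simp only [← linFormHom_apply, LinearMap.add_comp, map_add, map_sub]
        ring
      map_smul' := fun c φ => by
        simp only [← linFormHom_apply, LinearMap.smul_comp, ← smul_sub, map_smul, RingHom.id_apply,
          ← Polynomial.smul_C, smul_add, mul_smul_comm] }
    (fun i => aeval_X _ i) φ

theorem eval_one_deform (p : (Fin (N + 1) → K) →ₗ[K] (Fin (N + 1) → K)) (F : CoordRing K N) :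
    (deform p F).eval 1 = F := by
  have : ((Polynomial.aeval (1 : CoordRing K N)).restrictScalars K).comp (deform p) =
      AlgHom.id K (CoordRing K N) := by
    refine MvPolynomial.algHom_ext fun i => ?_
    rw [AlgHom.comp_apply, ← linForm_proj i, deform_linForm]
    simp only [AlgHom.restrictScalars_apply, map_add, map_mul, Polynomial.aeval_C,
      Polynomial.aeval_X, one_mul, Algebra.algebraMap_self, RingHom.id_apply, AlgHom.id_apply]
    rw [← linFormHom_apply, ← linFormHom_apply, ← linFormHom_apply, map_sub, add_sub_cancel]
  simpa [Polynomial.coe_aeval_eq_eval] using DFunLike.congr_fun this F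

theorem exists_isProj (L : LinSub K N) :
    ∃ p : (Fin (N + 1) → K) →ₗ[K] (Fin (N + 1) → K), LinearMap.IsProj L p := by
  obtain ⟨f, hf⟩ := L.subtype.exists_leftInverse_of_injective L.ker_subtype
  exact ⟨L.subtype ∘ₗ f, fun x => (f x).2,
    fun x hx => congrArg Subtype.val (LinearMap.congr_fun hf ⟨x, hx⟩)⟩

theorem sub_comp_isProj_mem {L : LinSub K N} {p : (Fin (N + 1) → K) →ₗ[K] (Fin (N + 1) → K)}
    (hp : LinearMap.IsProj L p) (φ : Module.Dual K (Fin (N + 1) → K)) :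
    φ - φ ∘ₗ p ∈ L.dualAnnihilator := by
  rw [Submodule.mem_dualAnnihilator]
  intro v hv
  simp [hp.map_id v hv]

theorem comp_isProj_eq_zero_iff {L : LinSub K N}
    {p : (Fin (N + 1) → K) →ₗ[K] (Fin (N + 1) → K)} (hp : LinearMap.IsProj L p)
    (φ : Module.Dual K (Fin (N + 1) → K)) : φ ∘ₗ p = 0 ↔ φ ∈ L.dualAnnihilator := by
  rw [Submodule.mem_dualAnnihilator]
  constructor
  · intro h v hv
    have := LinearMap.congr_fun h v
    rwa [LinearMap.comp_apply, hp.map_id v hv] at this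
  · intro h
    ext1 v
    exact LinearMap.ext_ring (h _ (hp.map_mem _))

theorem linForm_mem_linIdeal {L : LinSub K N} {φ : Module.Dual K (Fin (N + 1) → K)}
    (h : φ ∈ L.dualAnnihilator) : linForm φ ∈ linIdeal L :=
  Ideal.subset_span ⟨φ, h, rfl⟩

/-- Each variable maps to a constant plus `T` times a form vanishing on `L`, so the coefficient of
`T ^ i` lies in `I(L) ^ i`. -/
theorem deform_mem_reesAlgebra {L : LinSub K N}
    {p : (Fin (N + 1) → K) →ₗ[K] (Fin (N + 1) → K)} (hp : LinearMap.IsProj L p)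
    (F : CoordRing K N) : deform p F ∈ reesAlgebra (linIdeal L) := by
  induction F using MvPolynomial.induction_on with
  | C a =>
    have h : deform p (C a) = algebraMap (CoordRing K N) _ (C a) := by
      rw [← algebraMap_eq, AlgHom.commutes]
      rfl
    rw [h]
    exact Subalgebra.algebraMap_mem _ _
  | add F G hF hG => rw [map_add]; exact add_mem hF hG
  | mul_X F i hF =>
    rw [map_mul, ← linForm_proj i, deform_linForm]
    refine mul_mem hF (add_mem (Subalgebra.algebraMap_mem _ _) ?_)
    rw [mul_comm, Polynomial.C_mul_X_eq_monomial]
    rw [reesAlgebra.monomial_mem, pow_one]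
    exact linForm_mem_linIdeal (sub_comp_isProj_mem hp _)

theorem deform_linForm_of_mem {L : LinSub K N}
    {p : (Fin (N + 1) → K) →ₗ[K] (Fin (N + 1) → K)} (hp : LinearMap.IsProj L p)
    {φ : Module.Dual K (Fin (N + 1) → K)} (h : φ ∈ L.dualAnnihilator) :
    deform p (linForm φ) = Polynomial.X * Polynomial.C (linForm φ) := by
  simp [deform_linForm, (comp_isProj_eq_zero_iff hp φ).2 h]

/-- The order of vanishing along `L` is the order at `T = 0` of the deformation. -/
theorem mem_linIdeal_pow_iff {L : LinSub K N}
    {p : (Fin (N + 1) → K) →ₗ[K] (Fin (N + 1) → K)} (hp : LinearMap.IsProj L p)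
    (F : CoordRing K N) (r : ℕ) :
    F ∈ linIdeal L ^ r ↔ Polynomial.X ^ r ∣ deform p F := by
  constructor
  · have h1 : (linIdeal L).map (deform p) ≤ Ideal.span {Polynomial.X} := by
      rw [linIdeal, Ideal.map_span, Ideal.span_le]
      rintro _ ⟨_, ⟨φ, hφ, rfl⟩, rfl⟩
      exact Ideal.mem_span_singleton.2 ⟨_, deform_linForm_of_mem hp hφ⟩
    intro hF
    have h2 := Ideal.mem_map_of_mem (deform p) hF
    rw [Ideal.map_pow] at h2
    have h3 := Ideal.pow_right_mono h1 r h2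
    rwa [Ideal.span_singleton_pow, Ideal.mem_span_singleton] at h3
  · intro h
    -- At `T = 1` the deformation returns `F`, which is thus the sum of the coefficients; those
    -- below `r` vanish and the others lie in `I(L) ^ r`.
    rw [← eval_one_deform p F, Polynomial.eval_eq_sum, Polynomial.sum]
    refine Ideal.sum_mem _ fun i _ => ?_
    rw [one_pow, mul_one]
    rcases lt_or_ge i r with hi | hi
    · rw [Polynomial.X_pow_dvd_iff.1 h i hi]
      exact zero_mem _
    · exact Ideal.pow_le_pow_right hi ((mem_reesAlgebra_iff _ _).1 (deform_mem_reesAlgebra hp F) i)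

theorem linForm_mem_linIdeal_iff {L : LinSub K N} {φ : Module.Dual K (Fin (N + 1) → K)} :
    linForm φ ∈ linIdeal L ↔ φ ∈ L.dualAnnihilator := by
  refine ⟨fun h => ?_, linForm_mem_linIdeal⟩
  obtain ⟨p, hp⟩ := exists_isProj L
  rw [← pow_one (linIdeal L), mem_linIdeal_pow_iff hp, pow_one, Polynomial.X_dvd_iff,
    deform_linForm] at h
  rw [← comp_isProj_eq_zero_iff hp]
  apply linForm_injective
  simpa using h

theorem mem_linIdeal_iff {L : LinSub K N}
    {p : (Fin (N + 1) → K) →ₗ[K] (Fin (N + 1) → K)} (hp : LinearMap.IsProj L p)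
    (F : CoordRing K N) : F ∈ linIdeal L ↔ Polynomial.X ∣ deform p F := by
  simpa using mem_linIdeal_pow_iff hp F 1

instance linIdeal_isPrime (L : LinSub K N) : (linIdeal L).IsPrime := by
  obtain ⟨p, hp⟩ := exists_isProj L
  refine ⟨fun h => ?_, fun {F G} h => ?_⟩
  · have := (mem_linIdeal_iff hp 1).1 (h ▸ Submodule.mem_top)
    rw [map_one] at this
    exact Polynomial.not_isUnit_X (isUnit_of_dvd_one this)
  · simp only [mem_linIdeal_iff hp, map_mul] at h ⊢
    exact Polynomial.prime_X.dvd_or_dvd h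

/-- `T` is prime, so a factor not divisible by it can be cancelled. This makes powers of `I(L)`
primary. -/
theorem mem_linIdeal_pow_of_mul_mem {L : LinSub K N} {u F : CoordRing K N} {r : ℕ}
    (hu : u ∉ linIdeal L) (h : u * F ∈ linIdeal L ^ r) : F ∈ linIdeal L ^ r := by
  obtain ⟨p, hp⟩ := exists_isProj L
  rw [mem_linIdeal_iff hp] at hu
  rw [mem_linIdeal_pow_iff hp] at h ⊢
  rw [map_mul] at h
  exact Polynomial.prime_X.pow_dvd_of_dvd_mul_left r hu h

theorem mem_linIdeal_pow_of_linForm_mul_mem {L : LinSub K N}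
    {φ : Module.Dual K (Fin (N + 1) → K)} (hφ : φ ≠ 0) {F : CoordRing K N} {r : ℕ}
    (h : linForm φ * F ∈ linIdeal L ^ r) : F ∈ linIdeal L ^ (r - 1) := by
  by_cases hL : φ ∈ L.dualAnnihilator
  · obtain _ | r := r
    · simp
    obtain ⟨p, hp⟩ := exists_isProj L
    rw [mem_linIdeal_pow_iff hp] at h ⊢
    rw [map_mul, deform_linForm_of_mem hp hL, pow_succ', mul_assoc,
      mul_dvd_mul_iff_left Polynomial.X_ne_zero] at h
    -- The linear form has order exactly one along `L`: its deformation is `T` times a nonzero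
    -- constant in `T`.
    refine Polynomial.prime_X.pow_dvd_of_dvd_mul_left r ?_ h
    rw [Polynomial.X_dvd_iff, Polynomial.coeff_C_zero]
    exact linForm_ne_zero hφ
  · exact Ideal.pow_le_pow_right (Nat.sub_le _ _)
      (mem_linIdeal_pow_of_mul_mem (mt linForm_mem_linIdeal_iff.1 hL) h)

theorem linIdeal_le_iff {L M : LinSub K N} : linIdeal M ≤ linIdeal L ↔ L ≤ M := by
  constructor
  · intro h
    rw [← Subspace.dualAnnihilator_le_dualAnnihilator_iff]
    intro φ hφ
    exact linForm_mem_linIdeal_iff.1 (h (linForm_mem_linIdeal hφ))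
  · intro h
    exact Ideal.span_mono (Set.image_mono (Submodule.dualAnnihilator_anti h))

/-! ### Symbolic powers of intersections of primes -/

section SymbolicPower

variable {R : Type*} [CommRing R]

theorem mem_associatedPrimes_of_mem_minimalPrimes [IsNoetherianRing R] {I P : Ideal R}
    (h : P ∈ I.minimalPrimes) : P ∈ associatedPrimes R (R ⧸ I) := by
  apply Module.associatedPrimes.minimalPrimes_annihilator_subset_associatedPrimes
  rwa [Ideal.annihilator_quotient]

theorem mem_localization_comap_iff {I P : Ideal R} [P.IsPrime] {x : R} :
    x ∈ (I.map (algebraMap R (Localization.AtPrime P))).comap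
      (algebraMap R (Localization.AtPrime P)) ↔ ∃ u ∉ P, u * x ∈ I := by
  rw [Ideal.mem_comap, IsLocalization.algebraMap_mem_map_algebraMap_iff P.primeCompl]
  rfl

theorem mem_symbolicPower_iff {I : Ideal R} {m : ℕ} {x : R} :
    x ∈ symbolicPower I m ↔
      ∀ P ∈ associatedPrimes R (R ⧸ I), ∃ u ∉ P, u * x ∈ I ^ m := by
  simp only [symbolicPower, Submodule.mem_iInf]
  refine forall₂_congr fun P hP => ?_
  have : P.IsPrime := hP.isPrime
  exact mem_localization_comap_iff

theorem pow_le_symbolicPower (I : Ideal R) (m : ℕ) : I ^ m ≤ symbolicPower I m := fun x hx =>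
  mem_symbolicPower_iff.2 fun P hP =>
    ⟨1, (Ideal.ne_top_iff_one P).1 hP.isPrime.ne_top, by simpa using hx⟩

theorem symbolicPower_le_pow {I P : Ideal R} {m k : ℕ} (hP : P ∈ associatedPrimes R (R ⧸ I))
    (hI : I ≤ P ^ m) (hprim : ∀ u ∉ P, ∀ x, u * x ∈ P ^ (m * k) → x ∈ P ^ (m * k)) :
    symbolicPower I k ≤ P ^ (m * k) := fun x hx => by
  obtain ⟨u, hu, hux⟩ := mem_symbolicPower_iff.1 hx P hP
  exact hprim u hu x (pow_mul P m k ▸ Ideal.pow_right_mono hI k hux)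

theorem mem_minimalPrimes_biInf {S : Finset (Ideal R)} (hS : ∀ P ∈ S, P.IsPrime)
    (hanti : IsAntichain (· ≤ ·) (S : Set (Ideal R))) {P : Ideal R} (hP : P ∈ S) :
    P ∈ (⨅ Q ∈ S, Q).minimalPrimes := by
  refine ⟨⟨hS P hP, iInf₂_le P hP⟩, fun Q ⟨hQ, hle⟩ hQP => ?_⟩
  rw [← Finset.inf_eq_iInf, hQ.inf_le'] at hle
  obtain ⟨P', hP', h⟩ := hle
  rwa [← hanti.eq hP' hP (h.trans hQP)]

/-- If `P` is the radical of the annihilator of the class of `x`, then `P` contains the intersection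
of the `Q` with `x ∉ Q`, hence one such `Q`; conversely `r ^ n * x ∈ Q` forces `r ∈ Q`. -/
theorem associatedPrimes_biInf_subset {S : Finset (Ideal R)} (hS : ∀ P ∈ S, P.IsPrime) :
    associatedPrimes R (R ⧸ ⨅ Q ∈ S, Q) ⊆ S := by
  intro P hP
  classical
  obtain ⟨hprime, y, hy⟩ := hP
  obtain ⟨x, rfl⟩ := Ideal.Quotient.mk_surjective y
  have hmem : ∀ r, r ∈ P ↔ ∃ n, ∀ Q ∈ S, r ^ n * x ∈ Q := by
    intro r
    have h : ∀ a : R, a • Ideal.Quotient.mk (⨅ Q ∈ S, Q) x = 0 ↔ ∀ Q ∈ S, a * x ∈ Q := by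
      intro a
      rw [← Ideal.Quotient.mk_eq_mk, ← Submodule.Quotient.mk_smul, Submodule.Quotient.mk_eq_zero]
      simp [Submodule.mem_iInf]
    rw [hy]
    simp only [Ideal.mem_radical_iff, Submodule.mem_colon_singleton, Submodule.mem_bot, h]
  have hle : (S.filter (x ∉ ·)).inf id ≤ P := by
    intro r hr
    refine (hmem r).2 ⟨1, fun Q hQ => ?_⟩
    rw [pow_one]
    by_cases hx : x ∈ Q
    · exact Q.mul_mem_left r hx
    · exact Q.mul_mem_right x (Finset.inf_le (f := id) (Finset.mem_filter.2 ⟨hQ, hx⟩) hr)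
  obtain ⟨Q, hQ, hQP⟩ := hprime.inf_le'.1 hle
  rw [Finset.mem_filter] at hQ
  have hPQ : P ≤ Q := fun r hr => by
    obtain ⟨n, hn⟩ := (hmem r).1 hr
    exact (hS Q hQ.1).mem_of_pow_mem n
      (((hS Q hQ.1).mem_or_mem (hn Q hQ.1)).resolve_right hQ.2)
  rw [le_antisymm hPQ hQP]
  exact hQ.1

theorem symbolicPower_biInf [IsNoetherianRing R] {S : Finset (Ideal R)}
    (hS : ∀ P ∈ S, P.IsPrime) (hanti : IsAntichain (· ≤ ·) (S : Set (Ideal R))) (m : ℕ)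
    (hprim : ∀ P ∈ S, ∀ u ∉ P, ∀ x, u * x ∈ P ^ m → x ∈ P ^ m) :
    symbolicPower (⨅ P ∈ S, P) m = ⨅ P ∈ S, P ^ m := by
  classical
  apply le_antisymm
  · refine le_iInf₂ fun P hP => ?_
    have := symbolicPower_le_pow (I := ⨅ P ∈ S, P) (P := P) (m := 1) (k := m)
      (mem_associatedPrimes_of_mem_minimalPrimes (mem_minimalPrimes_biInf hS hanti hP))
      (by rw [pow_one]; exact iInf₂_le P hP) (by simpa using hprim P hP)
    rwa [one_mul] at this
  · intro x hx
    rw [mem_symbolicPower_iff]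
    intro P hP
    have hPS : P ∈ S := associatedPrimes_biInf_subset hS hP
    have hJ : ¬ (S.erase P).inf id ≤ P := by
      rw [(hS P hPS).inf_le']
      rintro ⟨Q, hQ, hle⟩
      rw [Finset.mem_erase] at hQ
      exact hQ.1 (hanti.eq hQ.2 hPS hle)
    -- This `u` lies in every other prime but not in `P`, so `u ^ m` carries `P ^ m` into the `m`-th
    -- power of the intersection.
    obtain ⟨u, hu, huP⟩ := SetLike.not_le_iff_exists.1 hJ
    refine ⟨u ^ m, fun h => huP ((hS P hPS).mem_of_pow_mem m h), ?_⟩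
    have h1 : (S.erase P).inf id * P ≤ ⨅ Q ∈ S, Q := by
      refine le_iInf₂ fun Q hQ => ?_
      by_cases hQP : Q = P
      · subst hQP; exact Ideal.mul_le_right
      · exact Ideal.mul_le_left.trans <|
          Finset.inf_le (f := id) (Finset.mem_erase.2 ⟨hQP, hQ⟩)
    refine Ideal.pow_right_mono h1 m ?_
    rw [mul_pow]
    refine Ideal.mul_mem_mul (Ideal.pow_mem_pow hu m) ?_
    simp only [Submodule.mem_iInf] at hx
    exact hx P hPS

end SymbolicPower

theorem symbolicPower_biInf_linIdeal {S : Set (LinSub K N)} (hfin : S.Finite)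
    (hanti : IsAntichain (· ≤ ·) S) (m : ℕ) :
    symbolicPower (⨅ L ∈ S, linIdeal L) m = ⨅ L ∈ S, linIdeal L ^ m := by
  classical
  have h := symbolicPower_biInf (S := hfin.toFinset.image linIdeal) (m := m)
    (by simp only [Finset.mem_image]; rintro _ ⟨L, _, rfl⟩; infer_instance)
    (by
      rintro _ hL _ hM hne hle
      simp only [Finset.coe_image, Set.Finite.coe_toFinset] at hL hM
      obtain ⟨L, hL, rfl⟩ := hL
      obtain ⟨M, hM, rfl⟩ := hM
      exact hne (congrArg _ (hanti.eq hM hL (linIdeal_le_iff.1 hle)).symm))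
    (by
      simp only [Finset.mem_image]
      rintro _ ⟨L, _, rfl⟩ u hu x hx
      exact mem_linIdeal_pow_of_mul_mem hu hx)
  have himage : ∀ f : Ideal (CoordRing K N) → Ideal (CoordRing K N),
      ⨅ P ∈ hfin.toFinset.image linIdeal, f P = ⨅ L ∈ S, f (linIdeal L) := by
    intro f
    rw [← Finset.inf_eq_iInf, Finset.inf_image, Finset.inf_eq_iInf]
    simp
  rwa [himage, himage] at h

theorem symbolicPower_linIdeal (L : LinSub K N) (m : ℕ) :
    symbolicPower (linIdeal L) m = linIdeal L ^ m := by
  simpa using symbolicPower_biInf_linIdeal (Set.finite_singleton L) IsAntichain.singleton m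

/-! ### Restriction to hyperplanes -/

theorem totalDegree_pullback_le (f : (Fin (N + 1) → K) →ₗ[K] (Fin (N + 1) → K))
    (F : CoordRing K N) : (pullback f F).totalDegree ≤ F.totalDegree := by
  conv_lhs => rw [← sum_homogeneousComponent F, map_sum]
  refine totalDegree_finsetSum_le fun i hi => ?_
  exact (isHomogeneous_pullback f (homogeneousComponent_isHomogeneous i F)).totalDegree_le.trans
    (Nat.lt_succ_iff.1 (Finset.mem_range.1 hi))

theorem pullback_mem_linIdeal_pow {f : (Fin (N + 1) → K) →ₗ[K] (Fin (N + 1) → K)}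
    {L M : LinSub K N} (h : M ≤ L.comap f) {F : CoordRing K N} {r : ℕ}
    (hF : F ∈ linIdeal L ^ r) : pullback f F ∈ linIdeal M ^ r := by
  have h1 : (linIdeal L).map (pullback f) ≤ linIdeal M := by
    rw [linIdeal, Ideal.map_span, Ideal.span_le]
    rintro _ ⟨_, ⟨φ, hφ, rfl⟩, rfl⟩
    rw [SetLike.mem_coe, pullback_linForm]
    refine linForm_mem_linIdeal ?_
    rw [SetLike.mem_coe, Submodule.mem_dualAnnihilator] at hφ
    rw [Submodule.mem_dualAnnihilator]
    exact fun v hv => hφ _ (h hv)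
  have h2 := Ideal.mem_map_of_mem (pullback f) hF
  rw [Ideal.map_pow] at h2
  exact Ideal.pow_right_mono h1 r h2

theorem dualAnnihilator_biInf_ker {ι : Type*} (H : ι → Module.Dual K (Fin (N + 1) → K))
    (J : Finset ι) :
    (⨅ j ∈ J, LinearMap.ker (H j)).dualAnnihilator = Submodule.span K (H '' (J : Set ι)) := by
  apply le_antisymm
  · intro φ hφ
    have := mem_span_of_iInf_ker_le_ker (L := fun j : J => H j) (K := φ) (by
      rw [iInf_subtype]
      exact fun v hv => (Submodule.mem_dualAnnihilator φ).1 hφ v hv)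
    rwa [Set.image_eq_range]
  · rw [Submodule.span_le]
    rintro _ ⟨j, hj, rfl⟩
    rw [SetLike.mem_coe, Submodule.mem_dualAnnihilator]
    exact fun v hv => (iInf₂_le j hj : ⨅ j ∈ J, LinearMap.ker (H j) ≤ LinearMap.ker (H j)) hv

theorem dualAnnihilator_ker (φ : Module.Dual K (Fin (N + 1) → K)) :
    (LinearMap.ker φ).dualAnnihilator = Submodule.span K {φ} := by
  simpa using dualAnnihilator_biInf_ker (fun _ : Unit => φ) Finset.univ

theorem linIdeal_ker (φ : Module.Dual K (Fin (N + 1) → K)) :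
    linIdeal (LinearMap.ker φ) = Ideal.span {linForm φ} := by
  rw [linIdeal, dualAnnihilator_ker]
  apply le_antisymm
  · rw [Ideal.span_le]
    rintro _ ⟨ψ, hψ, rfl⟩
    obtain ⟨c, rfl⟩ := Submodule.mem_span_singleton.1 hψ
    rw [SetLike.mem_coe, Ideal.mem_span_singleton, linForm_smul, smul_eq_C_mul]
    exact Dvd.intro_left _ rfl
  · exact Ideal.span_mono (Set.singleton_subset_iff.2 ⟨φ, Submodule.mem_span_singleton_self φ, rfl⟩)

/-- Pullback along a projection onto the hyperplane plays the role of restriction inside the same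
ring: it changes `F` only modulo the linear form. -/
theorem linForm_dvd_of_pullback_eq_zero {φ : Module.Dual K (Fin (N + 1) → K)}
    {p : (Fin (N + 1) → K) →ₗ[K] (Fin (N + 1) → K)} (hp : LinearMap.IsProj (LinearMap.ker φ) p)
    {F : CoordRing K N} (h : pullback p F = 0) : linForm φ ∣ F := by
  rw [← Ideal.mem_span_singleton, ← linIdeal_ker, ← sub_zero F, ← h]
  refine sub_pullback_mem p _ (fun i => ?_) F
  rw [← linForm_proj, ← linForm_sub]
  exact linForm_mem_linIdeal (sub_comp_isProj_mem hp _)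

/-! ### The degree bound -/

section DegreeBound

variable {ι : Type*} [DecidableEq ι]

/-- The functionals killed by composition with `p` are the multiples of `H i`, which meet the span
of the others trivially. -/
theorem linearIndepOn_comp_isProj {H : ι → Module.Dual K (Fin (N + 1) → K)} {i : ι}
    {p : (Fin (N + 1) → K) →ₗ[K] (Fin (N + 1) → K)}
    (hp : LinearMap.IsProj (LinearMap.ker (H i)) p) {J : Finset ι} (hi : i ∉ J)
    (hJ : LinearIndepOn K H (insert i J : Finset ι)) :
    LinearIndepOn K (fun j => H j ∘ₗ p) J := by
  rw [Finset.coe_insert, linearIndepOn_insert (by simpa using hi)] at hJ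
  refine hJ.1.linearIndependent.map (f := p.dualMap) ?_
  rw [← Set.image_eq_range, Submodule.disjoint_def]
  intro φ hφ hker
  have h0 : φ ∘ₗ p = 0 := hker
  rw [comp_isProj_eq_zero_iff hp, dualAnnihilator_ker] at h0
  obtain ⟨c, rfl⟩ := Submodule.mem_span_singleton.1 h0
  by_cases hc : c = 0
  · simp [hc]
  · exact absurd ((Submodule.smul_mem_iff _ hc).1 hφ) hJ.2

theorem sum_powersetCard_filter_mem {S : Finset ι} {i : ι} (hi : i ∈ S) (e : ℕ)
    (r : Finset ι → ℕ) :
    ∑ J ∈ (S.powersetCard (e + 1)).filter (i ∈ ·), r J =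
      ∑ J ∈ (S.erase i).powersetCard e, r (insert i J) := by
  refine Finset.sum_bij' (fun J _ => J.erase i) (fun J _ => insert i J) ?_ ?_ ?_ ?_ ?_
  · intro J hJ
    simp only [Finset.mem_filter, Finset.mem_powersetCard] at hJ ⊢
    exact ⟨Finset.erase_subset_erase i hJ.1.1, by rw [Finset.card_erase_of_mem hJ.2, hJ.1.2]; rfl⟩
  · intro J hJ
    simp only [Finset.mem_filter, Finset.mem_powersetCard, Finset.subset_erase] at hJ ⊢
    exact ⟨⟨Finset.insert_subset hi hJ.1.1, by rw [Finset.card_insert_of_notMem hJ.1.2, hJ.2]⟩,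
      Finset.mem_insert_self i J⟩
  · intro J hJ
    exact Finset.insert_erase (Finset.mem_filter.1 hJ).2
  · intro J hJ
    simp only [Finset.mem_powersetCard, Finset.subset_erase] at hJ
    exact Finset.erase_insert hJ.1.2
  · intro J hJ
    rw [Finset.insert_erase (Finset.mem_filter.1 hJ).2]

/-- Double counting: each set occurs once for each of its `e + 1` elements. -/
theorem sum_sum_powersetCard_erase (S : Finset ι) (e : ℕ) (r : Finset ι → ℕ) :
    ∑ i ∈ S, ∑ J ∈ (S.erase i).powersetCard e, r (insert i J) =
      (e + 1) * ∑ J ∈ S.powersetCard (e + 1), r J := by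
  rw [← Finset.sum_congr rfl fun i hi => sum_powersetCard_filter_mem hi e r]
  simp only [Finset.sum_filter]
  rw [Finset.sum_comm, Finset.mul_sum]
  refine Finset.sum_congr rfl fun J hJ => ?_
  rw [Finset.mem_powersetCard] at hJ
  rw [← Finset.sum_filter, Finset.sum_const, Finset.filter_mem_eq_inter,
    Finset.inter_eq_right.2 hJ.1, hJ.2, smul_eq_mul]

/-- Averaging gives slightly more than needed, as `(s + 2) / (e + 2) ≤ (s + 1) / (e + 1)` for `e ≤
s`. -/
theorem averaging_le {s e A B : ℕ} (hes : e ≤ s)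
    (h : (e + 2) * A ≤ (s + 2) * (s.choose e * B)) : A ≤ (s + 1).choose (e + 1) * B := by
  have h1 := Nat.add_one_mul_choose_eq s e
  have h2 : (s + 2) * (e + 1) ≤ (e + 2) * (s + 1) := by nlinarith
  refine le_of_mul_le_mul_left ?_ (show 0 < (e + 2) * (s + 1) by positivity)
  calc (e + 2) * (s + 1) * A = (s + 1) * ((e + 2) * A) := by ring
    _ ≤ (s + 1) * ((s + 2) * (s.choose e * B)) := Nat.mul_le_mul_left _ h
    _ = (s + 2) * ((s + 1) * s.choose e) * B := by ring
    _ = (s + 2) * (e + 1) * ((s + 1).choose (e + 1) * B) := by rw [h1]; ring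
    _ ≤ _ := Nat.mul_le_mul_right _ h2

theorem linForm_notMem_linIdeal {H : ι → Module.Dual K (Fin (N + 1) → K)} {i : ι}
    {J : Finset ι} (hi : i ∉ J) (hJ : LinearIndepOn K H (insert i J : Finset ι)) :
    linForm (H i) ∉ linIdeal (⨅ j ∈ J, LinearMap.ker (H j)) := by
  rw [Finset.coe_insert, linearIndepOn_insert (by simpa using hi)] at hJ
  rw [linForm_mem_linIdeal_iff, dualAnnihilator_biInf_ker]
  exact hJ.2

/-- It suffices to bound `∑ r J` for forms without a factor among the given linear forms. -/
theorem sum_order_le_of_not_dvd {e : ℕ} {H : ι → Module.Dual K (Fin (N + 1) → K)}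
    {S : Finset ι} (hH : ∀ J ⊆ S, J.card ≤ e + 2 → LinearIndepOn K H J)
    (core : ∀ (δ : ℕ) (r : Finset ι → ℕ) (G : CoordRing K N), G ≠ 0 → G.totalDegree ≤ δ →
      (∀ J ∈ S.powersetCard (e + 1), G ∈ linIdeal (⨅ j ∈ J, LinearMap.ker (H j)) ^ r J) →
      (∀ i ∈ S, ¬ linForm (H i) ∣ G) →
      ∑ J ∈ S.powersetCard (e + 1), r J ≤ (S.card - 1).choose e * δ)
    (δ : ℕ) (r : Finset ι → ℕ) (G : CoordRing K N) (hG0 : G ≠ 0) (hδ : G.totalDegree ≤ δ)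
    (hG : ∀ J ∈ S.powersetCard (e + 1), G ∈ linIdeal (⨅ j ∈ J, LinearMap.ker (H j)) ^ r J) :
    ∑ J ∈ S.powersetCard (e + 1), r J ≤ (S.card - 1).choose e * δ := by
  -- The orders must vary: dividing by the form of `i` lowers `r J` only for `J` containing `i`.
  induction δ using Nat.strong_induction_on generalizing r G with | _ δ ih
  by_cases hdvd : ∀ i ∈ S, ¬ linForm (H i) ∣ G
  · exact core δ r G hG0 hδ hG hdvd
  push Not at hdvd
  obtain ⟨i, hi, F, rfl⟩ := hdvd
  have hF0 : F ≠ 0 := right_ne_zero_of_mul hG0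
  have hHi : H i ≠ 0 := by
    rintro h
    exact left_ne_zero_of_mul hG0 (by rw [h, linForm_zero])
  rw [totalDegree_mul_of_isDomain (linForm_ne_zero hHi) hF0,
    (isHomogeneous_linForm (H i)).totalDegree (linForm_ne_zero hHi)] at hδ
  obtain _ | δ := δ
  · omega
  have h := ih δ (Nat.lt_succ_self δ) (fun J => r J - if i ∈ J then 1 else 0) F hF0
    (by omega) (fun J hJ => by
      split_ifs with hiJ
      · exact mem_linIdeal_pow_of_linForm_mul_mem hHi (hG J hJ)
      · rw [Finset.mem_powersetCard] at hJ
        exact mem_linIdeal_pow_of_mul_mem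
          (linForm_notMem_linIdeal hiJ (hH _ (Finset.insert_subset hi hJ.1)
            (by rw [Finset.card_insert_of_notMem hiJ, hJ.2])))
          (hG J (Finset.mem_powersetCard.2 hJ)))
  have hcount : ∑ J ∈ S.powersetCard (e + 1), (if i ∈ J then 1 else 0) =
      (S.card - 1).choose e := by
    rw [← Finset.sum_filter, sum_powersetCard_filter_mem hi e fun _ => 1]
    simp [Finset.card_erase_of_mem hi]
  calc ∑ J ∈ S.powersetCard (e + 1), r J
      ≤ ∑ J ∈ S.powersetCard (e + 1), ((r J - if i ∈ J then 1 else 0) + if i ∈ J then 1 else 0) :=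
        Finset.sum_le_sum fun J _ => le_tsub_add
    _ ≤ (S.card - 1).choose e * δ + (S.card - 1).choose e := by
        rw [Finset.sum_add_distrib, hcount]
        exact Nat.add_le_add_right h _
    _ = _ := by ring

/-- A nonzero form vanishing to order `r J` along the intersection of the hyperplanes indexed by
`J`, for each set `J` of `e + 1` of them, has degree at least `∑ r J / (|S| - 1 choose e)`. -/
theorem sum_order_le_choose_mul_degree (e : ℕ) (H : ι → Module.Dual K (Fin (N + 1) → K))
    (S : Finset ι) (hH : ∀ J ⊆ S, J.card ≤ e + 2 → LinearIndepOn K H J) (δ : ℕ)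
    (r : Finset ι → ℕ) (G : CoordRing K N) (hG0 : G ≠ 0) (hδ : G.totalDegree ≤ δ)
    (hG : ∀ J ∈ S.powersetCard (e + 1), G ∈ linIdeal (⨅ j ∈ J, LinearMap.ker (H j)) ^ r J) :
    ∑ J ∈ S.powersetCard (e + 1), r J ≤ (S.card - 1).choose e * δ := by
  induction e generalizing H S δ r G with
  | zero =>
    refine sum_order_le_of_not_dvd hH (fun δ r G _ _ hG hdvd => ?_) δ r G hG0 hδ hG
    rw [Finset.sum_eq_zero]
    · exact Nat.zero_le _
    intro J hJ
    by_contra hr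
    have hmem := Ideal.pow_le_self hr (hG J hJ)
    obtain ⟨hJS, hJ1⟩ := Finset.mem_powersetCard.1 hJ
    obtain ⟨i, rfl⟩ := Finset.card_eq_one.1 hJ1
    rw [Finset.iInf_singleton, linIdeal_ker, Ideal.mem_span_singleton] at hmem
    exact hdvd i (hJS (Finset.mem_singleton_self i)) hmem
  | succ e ih =>
    refine sum_order_le_of_not_dvd hH (fun δ r G _ hδ hG hdvd => ?_) δ r G hG0 hδ hG
    rcases lt_or_ge S.card (e + 2) with hcard | hcard
    · simp [Finset.powersetCard_eq_empty.2 hcard]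
    obtain ⟨s, hs⟩ := Nat.exists_eq_add_of_le' hcard
    have hi : ∀ i ∈ S, ∑ J ∈ (S.erase i).powersetCard (e + 1), r (insert i J) ≤
        (s + e).choose e * δ := by
      intro i hi
      -- On the hyperplane of `i`, the subspace of `insert i J` is cut out by the `e + 1` restricted
      -- forms of `J`.
      obtain ⟨p, hp⟩ := exists_isProj (LinearMap.ker (H i))
      have h := ih (fun j => H j ∘ₗ p) (S.erase i) (fun J hJ hJe => by
          rw [Finset.subset_erase] at hJ
          exact linearIndepOn_comp_isProj hp hJ.2 (hH _ (Finset.insert_subset hi hJ.1)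
            (by rw [Finset.card_insert_of_notMem hJ.2]; omega)))
        δ (fun J => r (insert i J)) (pullback p G)
        (fun h0 => hdvd i hi (linForm_dvd_of_pullback_eq_zero hp h0))
        ((totalDegree_pullback_le p G).trans hδ) (fun J hJ => by
          rw [Finset.mem_powersetCard, Finset.subset_erase] at hJ
          refine pullback_mem_linIdeal_pow ?_ (hG (insert i J) (Finset.mem_powersetCard.2
            ⟨Finset.insert_subset hi hJ.1.1, by rw [Finset.card_insert_of_notMem hJ.1.2, hJ.2]⟩))
          intro v hv
          simp only [Submodule.mem_iInf, Submodule.mem_comap, Finset.mem_insert] at hv ⊢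
          rintro j (rfl | hj)
          · exact hp.map_mem v
          · exact hv j hj)
      rw [Finset.card_erase_of_mem hi, hs] at h
      exact h
    have hsum := Finset.sum_le_sum hi
    rw [sum_sum_powersetCard_erase, Finset.sum_const, hs, smul_eq_mul] at hsum
    rw [hs]
    exact averaging_le (s := s + e) (Nat.le_add_left e s) hsum

end DegreeBound

/-! ### Star configurations and the ideal of `W` -/

section Star

variable {s : ℕ} {H : Fin s → Module.Dual K (Fin (N + 1) → K)} {e : ℕ}

theorem InGeneralPosition.linearIndepOn (hH : InGeneralPosition H) {J : Finset (Fin s)}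
    (hJ : J.card ≤ N + 1) : LinearIndepOn K H J :=
  hH J hJ

theorem InGeneralPosition.ne_zero (hH : InGeneralPosition H) (j : Fin s) : H j ≠ 0 :=
  (hH.linearIndepOn (J := {j}) (by simp)).ne_zero (by simp)

theorem finite_starSubspaces (H : Fin s → Module.Dual K (Fin (N + 1) → K)) (e : ℕ) :
    (starSubspaces H e).Finite :=
  (Set.finite_range fun J : Finset (Fin s) => ⨅ j ∈ J, LinearMap.ker (H j)).subset
    fun _ ⟨J, _, hL⟩ => ⟨J, hL.symm⟩

theorem finrank_dualAnnihilator_of_mem_starSubspaces (hH : InGeneralPosition H)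
    (he : e ≤ N + 1) {L : LinSub K N} (hL : L ∈ starSubspaces H e) :
    Module.finrank K L.dualAnnihilator = e := by
  obtain ⟨J, hJ, rfl⟩ := hL
  rw [dualAnnihilator_biInf_ker, Set.image_eq_range,
    finrank_span_eq_card (hH.linearIndepOn (J := J) (by omega)).linearIndependent]
  simpa using hJ

theorem codim_eq_finrank_dualAnnihilator (L : LinSub K N) :
    codim L = Module.finrank K L.dualAnnihilator := by
  rw [codim, ← Subspace.dual_finrank_eq]
  exact L.dualQuotEquivDualAnnihilator.finrank_eq

theorem codim_of_mem_starSubspaces (hH : InGeneralPosition H)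
    (he : e ≤ N + 1) {L : LinSub K N} (hL : L ∈ starSubspaces H e) : codim L = e := by
  rw [codim_eq_finrank_dualAnnihilator, finrank_dualAnnihilator_of_mem_starSubspaces hH he hL]

theorem ne_bot_of_codim_le {L : LinSub K N} (h : codim L ≤ N) : L ≠ ⊥ := by
  rintro rfl
  have := (Submodule.quotEquivOfEqBot (⊥ : LinSub K N) rfl).finrank_eq
  rw [codim, this, Module.finrank_fin_fun] at h
  omega

theorem ne_top_of_one_le_codim {L : LinSub K N} (h : 1 ≤ codim L) : L ≠ ⊤ := by
  rintro rfl
  rw [codim, Module.finrank_zero_of_subsingleton] at h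
  omega

theorem isAntichain_starSubspaces (hH : InGeneralPosition H) (he : e ≤ N + 1) :
    IsAntichain (· ≤ ·) (starSubspaces H e) := by
  intro L hL M hM hne hle
  refine hne (Submodule.eq_of_le_of_finrank_eq hle ?_)
  have h1 := codim_of_mem_starSubspaces hH he hL
  have h2 := codim_of_mem_starSubspaces hH he hM
  have h3 := L.finrank_quotient_add_finrank
  have h4 := M.finrank_quotient_add_finrank
  rw [codim] at h1 h2
  omega

theorem starSubspaces_nonempty (hes : e ≤ s) : (starSubspaces H e).Nonempty := by
  obtain ⟨J, _, hJ⟩ := Finset.exists_subset_card_eq (s := (Finset.univ : Finset (Fin s)))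
    (n := e) (by simpa using hes)
  exact ⟨_, J, hJ, rfl⟩

theorem symbolicPower_starIdeal (hH : InGeneralPosition H) (he : e ≤ N + 1) (m : ℕ) :
    symbolicPower (starIdeal H e) m = ⨅ L ∈ starSubspaces H e, linIdeal L ^ m :=
  symbolicPower_biInf_linIdeal (finite_starSubspaces H e) (isAntichain_starSubspaces hH he) m

theorem ideal_eq (hH : InGeneralPosition H) (he : e ≤ N + 1) (m : ℕ) (T : Finset (LinSub K N))
    (μ : LinSub K N → ℕ) :
    ideal H e m T μ =
      (⨅ M ∈ T, linIdeal M ^ μ M) ⊓ ⨅ L ∈ starSubspaces H e, linIdeal L ^ m := by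
  simp only [ideal, symbolicPower_linIdeal, symbolicPower_starIdeal hH he]

/-- Symbolic powers of `I(W)` vanish to order `m k` along the star configuration. -/
theorem symbolicPower_ideal_le (hH : InGeneralPosition H) (he : e ≤ N + 1) {m : ℕ} (hm : 1 ≤ m)
    {T : Finset (LinSub K N)} {μ : LinSub K N → ℕ}
    (hT : ∀ M ∈ T, 0 < μ M → ∀ L ∈ starSubspaces H e, ¬ L ≤ M) {L : LinSub K N}
    (hL : L ∈ starSubspaces H e) (k : ℕ) :
    symbolicPower (ideal H e m T μ) k ≤ linIdeal L ^ (m * k) := by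
  have hI : ideal H e m T μ ≤ linIdeal L ^ m := by
    rw [ideal_eq hH he]
    exact inf_le_right.trans (iInf₂_le L hL)
  refine symbolicPower_le_pow (mem_associatedPrimes_of_mem_minimalPrimes
    ⟨⟨inferInstance, hI.trans (Ideal.pow_le_self (by omega))⟩, fun Q ⟨hQ, hIQ⟩ hQL => ?_⟩) hI
    fun u hu x hx => mem_linIdeal_pow_of_mul_mem hu hx
  have hstar : ⨅ L ∈ starSubspaces H e, linIdeal L ^ m =
      (finite_starSubspaces H e).toFinset.inf fun L => linIdeal L ^ m := by
    simp [Finset.inf_eq_iInf]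
  -- A prime containing a finite intersection contains one of its members, here a power of some
  -- `I(M)` or of a star ideal.
  rw [ideal_eq hH he, hQ.inf_le, hstar, ← Finset.inf_eq_iInf, hQ.inf_le', hQ.inf_le'] at hIQ
  rcases hIQ with ⟨M, hM, hMQ⟩ | ⟨M, hM, hMQ⟩
  · have hμ : 0 < μ M := by
      rw [Nat.pos_iff_ne_zero]
      intro h0
      rw [h0, pow_zero, Ideal.one_eq_top, top_le_iff] at hMQ
      exact hQ.ne_top hMQ
    exact absurd (linIdeal_le_iff.1 ((hQ.le_of_pow_le hMQ).trans hQL)) (hT M hM hμ L hL)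
  · have hMQ' := hQ.le_of_pow_le hMQ
    have hLM := linIdeal_le_iff.1 (hMQ'.trans hQL)
    rwa [(isAntichain_starSubspaces hH he).eq hL ((Set.Finite.mem_toFinset _).1 hM) hLM]

/-- The lower bound for the degrees of forms in the symbolic powers of `I(W)`. -/
theorem le_degree_of_mem_starSubspaces (hH : InGeneralPosition H) (he1 : 1 ≤ e) (heN : e ≤ N)
    (hes : e ≤ s) {c δ : ℕ} {G : CoordRing K N} (hG0 : G ≠ 0) (hδ : G.IsHomogeneous δ)
    (hG : ∀ L ∈ starSubspaces H e, G ∈ linIdeal L ^ (e * c)) : s * c ≤ δ := by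
  obtain ⟨e, rfl⟩ := Nat.exists_eq_add_of_le' he1
  obtain ⟨s, rfl⟩ := Nat.exists_eq_add_of_le' (he1.trans hes)
  have h := sum_order_le_choose_mul_degree e H Finset.univ
    (fun J _ hJ => hH.linearIndepOn (by omega)) δ (fun _ => (e + 1) * c) G hG0 hδ.totalDegree_le
    (fun J hJ => hG _ ⟨J, (Finset.mem_powersetCard.1 hJ).2, rfl⟩)
  rw [Finset.sum_const, Finset.card_powersetCard, Finset.card_univ, Fintype.card_fin, smul_eq_mul,
    Nat.add_sub_cancel, ← mul_assoc, ← Nat.add_one_mul_choose_eq, mul_comm (s + 1), mul_assoc] at h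
  exact le_of_mul_le_mul_left h (Nat.choose_pos (by omega))

/-- A power of the product of the hyperplanes lies in `I(W)`. -/
theorem prod_linForm_pow_mem_ideal [Infinite K] (hH : InGeneralPosition H) (he : e ≤ N + 1) {t : ℕ}
    {T : Finset (LinSub K N)} {μ : LinSub K N → ℕ} (hT : IsAdmissible H e t T μ) :
    (∏ j, linForm (H j)) ^ t ∈ ideal H e (e * t) T μ := by
  rw [ideal_eq hH he]
  simp only [Ideal.mem_inf, Submodule.mem_iInf]
  constructor
  · intro M hM
    obtain ⟨j, hj⟩ : ∃ j, M ≤ LinearMap.ker (H j) := by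
      -- A vector space over an infinite field is not a finite union of proper subspaces.
      have hcover : ⋃ j, ((LinearMap.ker (H j)).comap M.subtype : Set M) = Set.univ := by
        refine Set.eq_univ_of_forall fun v => ?_
        simpa using hT.subset_union M hM v.2
      obtain ⟨j, hj⟩ := Subspace.exists_eq_top_of_iUnion_eq_univ hcover
      exact ⟨j, Submodule.comap_subtype_eq_top.1 hj⟩
    refine Ideal.pow_le_pow_right (hT.mult_le M hM) (Ideal.pow_mem_pow ?_ t)
    refine Ideal.mem_of_dvd _ (Finset.dvd_prod_of_mem (fun j => linForm (H j))
      (Finset.mem_univ j)) (linForm_mem_linIdeal ?_)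
    rw [Submodule.mem_dualAnnihilator]
    exact fun v hv => hj hv
  · rintro L ⟨J, hJ, rfl⟩
    rw [pow_mul]
    refine Ideal.pow_mem_pow ?_ t
    refine Ideal.mem_of_dvd _ (Finset.prod_dvd_prod_of_subset J _ (fun j => linForm (H j))
      (Finset.subset_univ J)) ?_
    rw [← hJ, ← Finset.prod_const]
    refine Ideal.prod_mem_prod fun j hj => linForm_mem_linIdeal ?_
    rw [dualAnnihilator_biInf_ker]
    exact Submodule.subset_span ⟨j, hj, rfl⟩

theorem alpha_symbolicPower_ideal [Infinite K] (hH : InGeneralPosition H) {t : ℕ} (ht : 1 ≤ t)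
    (he1 : 1 ≤ e) (heN : e ≤ N) (hes : e ≤ s) {T : Finset (LinSub K N)} {μ : LinSub K N → ℕ}
    (hT : IsAdmissible H e t T μ) (k : ℕ) :
    alpha (symbolicPower (ideal H e (e * t) T μ) k) = s * t * k := by
  refine IsLeast.csInf_eq ⟨⟨((∏ j, linForm (H j)) ^ t) ^ k, ?_, ?_, ?_⟩, ?_⟩
  · exact pow_le_symbolicPower _ k
      (Ideal.pow_mem_pow (prod_linForm_pow_mem_ideal hH (by omega) hT) k)
  · exact pow_ne_zero k (pow_ne_zero t
      (Finset.prod_ne_zero_iff.2 fun j _ => linForm_ne_zero (hH.ne_zero j)))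
  · have := IsHomogeneous.prod Finset.univ (fun j => linForm (H j)) (fun _ => 1)
      fun j _ => isHomogeneous_linForm (H j)
    simpa using (this.pow t).pow k
  · rintro δ ⟨G, hG, hG0, hδ⟩
    rw [mul_assoc]
    refine le_degree_of_mem_starSubspaces hH he1 heN hes hG0 hδ fun L hL => ?_
    rw [← mul_assoc]
    exact symbolicPower_ideal_le hH (by omega) (Nat.mul_pos he1 ht) hT.not_star_le hL k hG

theorem isFatFlatIdeal_ideal (hH : InGeneralPosition H) {t : ℕ} (ht : 1 ≤ t)
    (he1 : 1 ≤ e) (heN : e ≤ N) (hes : e ≤ s) {T : Finset (LinSub K N)} {μ : LinSub K N → ℕ}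
    (hT : IsAdmissible H e t T μ)
    (hanti : IsAntichain (· ≤ ·) ({M | M ∈ T ∧ 0 < μ M} ∪ starSubspaces H e)) :
    IsFatFlatIdeal (ideal H e (e * t) T μ) := by
  classical
  have hfin := finite_starSubspaces H e
  refine ⟨T.filter (0 < μ ·) ∪ hfin.toFinset,
    -- No conflict arises: a star subspace in `T` has `μ` zero by `not_star_le`.
    fun L => if L ∈ starSubspaces H e then e * t else μ L, ?_, ?_, ?_, ?_⟩
  · obtain ⟨L, hL⟩ := starSubspaces_nonempty (H := H) hes
    exact ⟨L, Finset.mem_union_right _ (hfin.mem_toFinset.2 hL)⟩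
  · intro L hL
    by_cases hLs : L ∈ starSubspaces H e
    · have hcodim := codim_of_mem_starSubspaces hH (by omega) hLs
      beta_reduce
      rw [if_pos hLs]
      exact ⟨ne_bot_of_codim_le (by omega), ne_top_of_one_le_codim (by omega),
        Nat.mul_pos he1 ht⟩
    · simp only [Finset.mem_union, Finset.mem_filter, hfin.mem_toFinset, hLs, or_false] at hL
      have hcodim := hT.codim_mem L hL.1
      beta_reduce
      rw [if_neg hLs]
      exact ⟨ne_bot_of_codim_le hcodim.2, ne_top_of_one_le_codim (by omega), hL.2⟩
  · simpa [Set.ofPred_and] using hanti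
  · rw [ideal_eq hH (by omega), Finset.iInf_union]
    congr 1
    · refine le_antisymm (le_iInf₂ fun M hM => ?_) (le_iInf₂ fun M hM => ?_)
      · rw [Finset.mem_filter] at hM
        beta_reduce
        rw [if_neg fun h => hT.not_star_le M hM.1 hM.2 M h le_rfl]
        exact iInf₂_le M hM.1
      · rcases Nat.eq_zero_or_pos (μ M) with h0 | hpos
        · simp [h0]
        · refine (iInf₂_le M (Finset.mem_filter.2 ⟨hM, hpos⟩)).trans ?_
          beta_reduce
          rw [if_neg fun h => hT.not_star_le M hM hpos M h le_rfl]
    · simp only [hfin.mem_toFinset]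
      exact iInf_congr fun L => iInf_congr fun hL => by rw [if_pos hL]

end Star

/-! ### Existence and the Waldschmidt constant -/

theorem exists_inGeneralPosition [Infinite K] (s : ℕ) :
    ∃ H : Fin s → Module.Dual K (Fin (N + 1) → K), InGeneralPosition H := by
  let a : Fin s ↪ K := Fin.valEmbedding.trans (Infinite.natEmbedding K)
  -- Coefficient vectors are points of the moment curve; independence is a Vandermonde argument on
  -- the first `J.card` coordinates.
  refine ⟨fun j => ∑ i : Fin (N + 1), a j ^ (i : ℕ) • LinearMap.proj i, fun J hJ => ?_⟩
  rw [Fintype.linearIndependent_iff]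
  intro g hg
  let σ := J.equivFin
  have h0 : (fun i => g (σ.symm i)) = 0 := by
    refine Matrix.eq_zero_of_forall_pow_sum_mul_pow_eq_zero
      (f := fun i => a (σ.symm i)) (fun i j hij => ?_) fun i => ?_
    · simpa using a.injective hij
    · have h := LinearMap.congr_fun hg (Pi.single (Fin.castLE hJ i) 1)
      rw [← Equiv.sum_comp σ.symm] at h
      simpa [Pi.single_apply] using h
  intro j
  simpa using congrFun h0 (σ j)

theorem isWaldschmidtConstant_of_forall {I : Ideal (CoordRing K N)} {d : ℕ}
    (h : ∀ k : ℕ, 1 ≤ k → alpha (symbolicPower I k) = d * k) : IsWaldschmidtConstant I d := by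
  have hdiv : ∀ k : ℕ, 1 ≤ k → (alpha (symbolicPower I k) : ℝ) / k = d := by
    intro k hk
    have hk0 : (k : ℝ) ≠ 0 := by positivity
    rw [h k hk, Nat.cast_mul, mul_div_cancel_right₀ _ hk0]
  constructor
  · exact tendsto_const_nhds.congr' ((eventually_ge_atTop 1).mono fun k hk => (hdiv k hk).symm)
  · have hset : {x : ℝ | ∃ k : ℕ, 1 ≤ k ∧ x = (alpha (symbolicPower I k) : ℝ) / k} = {(d : ℝ)} := by
      ext x
      constructor
      · rintro ⟨k, hk, rfl⟩
        exact hdiv k hk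
      · rintro rfl
        exact ⟨1, le_rfl, (hdiv 1 le_rfl).symm⟩
    rw [hset]
    exact isGLB_singleton

end

end FatFlat

theorem theoremA (K : Type*) [Field K] [Infinite K] (N : ℕ) (hN : 3 ≤ N) (d : ℕ) (hd : 1 ≤ d) :
    -- a fat flat subscheme of `ℙ^N` with the stated invariants exists
    (∃ I : Ideal (FatFlat.CoordRing K N), FatFlat.IsFatFlatIdeal I ∧
      (∀ k : ℕ, 1 ≤ k → FatFlat.alpha (FatFlat.symbolicPower I k) = d * k) ∧
      FatFlat.IsWaldschmidtConstant I (d : ℝ)) ∧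
    -- every `W' + m S_N(e, s)` with `d = s t` and `m = e t` has them
    (∀ s t e : ℕ, d = s * t → 1 ≤ e → e ≤ N → e ≤ s →
      (∃ H : Fin s → Module.Dual K (Fin (N + 1) → K), FatFlat.InGeneralPosition H) ∧
      ∀ H : Fin s → Module.Dual K (Fin (N + 1) → K), FatFlat.InGeneralPosition H →
        ∀ (T : Finset (FatFlat.LinSub K N)) (μ : FatFlat.LinSub K N → ℕ),
          FatFlat.IsAdmissible H e t T μ →
          (∀ k : ℕ, 1 ≤ k →
            FatFlat.alpha (FatFlat.symbolicPower (FatFlat.ideal H e (e * t) T μ) k) = d * k) ∧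
          FatFlat.IsWaldschmidtConstant (FatFlat.ideal H e (e * t) T μ) (d : ℝ) ∧
          (IsAntichain (· ≤ ·) ({M | M ∈ T ∧ 0 < μ M} ∪ FatFlat.starSubspaces H e) →
            FatFlat.IsFatFlatIdeal (FatFlat.ideal H e (e * t) T μ))) := by
  constructor
  -- Witness: `s = d`, `t = 1`, no `M`'s, and the largest admissible `e`; any `e` from `1` to `min d
  -- N` would do.
  · obtain ⟨H, hH⟩ := FatFlat.exists_inGeneralPosition (K := K) (N := N) d
    have he1 : 1 ≤ min d N := le_min hd (by omega)
    have hT : FatFlat.IsAdmissible H (min d N) 1 ∅ 0 := by constructor <;> simp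
    have halpha : ∀ k : ℕ, 1 ≤ k → FatFlat.alpha (FatFlat.symbolicPower
        (FatFlat.ideal H (min d N) (min d N * 1) ∅ 0) k) = d * k := fun k _ => by
      simpa using FatFlat.alpha_symbolicPower_ideal hH le_rfl he1 (min_le_right _ _)
        (min_le_left _ _) hT k
    refine ⟨_, FatFlat.isFatFlatIdeal_ideal hH le_rfl he1 (min_le_right _ _) (min_le_left _ _) hT
      ?_, halpha, FatFlat.isWaldschmidtConstant_of_forall halpha⟩
    simpa using FatFlat.isAntichain_starSubspaces hH ((min_le_right d N).trans (Nat.le_succ N))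
  · rintro s t e rfl he1 heN hes
    refine ⟨FatFlat.exists_inGeneralPosition s, fun H hH T μ hT => ?_⟩
    have ht : 1 ≤ t := Nat.pos_of_mul_pos_left hd
    have halpha := FatFlat.alpha_symbolicPower_ideal hH ht he1 heN hes hT
    exact ⟨fun k _ => halpha k, FatFlat.isWaldschmidtConstant_of_forall fun k _ => halpha k,
      FatFlat.isFatFlatIdeal_ideal hH ht he1 heN hes hT⟩
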